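/- Let $K:\mathbb R\to\mathbb R$ be a continuous covariance kernel of period one: $K$ is continuous and $1$-periodic, and $(x,y)\mapsto K(x-y)$ is symmetric and positive semidefinite. Assume $\int_0^1 K(x)\,dx>0$. Let $({\bf K}f)(x)=\int_0^1 K(x-y)f(y)\,dy$ be the covariance operator; its eigenfunctions are $e^{2\pi i n x}$, $n\in\mathbb Z$, with eigenvalues $\widehat K(n)=\int_0^1 e^{-2\pi i n x}K(x)\,dx\ge 0$. For a continuous $1$-periodic $q:\mathbb R\to\mathbb R$ put $$J(q)=\tfrac12\langle q,{\bf K}^{-1}q\rangle=\tfrac12\sum_{n\in\mathbb Z}\frac{|\widehat q(n)|^2}{\widehat K(n)}\in[0,\infty],$$ where a term with $\widehat q(n)=0$ is $0$ and a term with $\widehat q(n)\ne0=\widehat K(n)$ is $\infty$. For $\lambda\in\mathbb R$ let $$A_\lambda=\Bigl\{\lambda+p'+p^2 \;:\; p\in C^\infty(\mathbb R;\mathbb R),\ p \text{ is } 1\text{-periodic},\ \int_0^1 p(x)\,dx=0\Bigr\}.$$ Then $$\liminf_{\lambda\to-\infty}\frac1{\lambda^2}\inf_{q\in A_\lambda}J(q)\;\ge\;\frac1{2K(0)}.$$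 -/

import Mathlib

open Filter Topology
open scoped ENNReal ContDiff

noncomputable section

/-- A continuous covariance kernel of a stationary real process of period one: `K` is continuous,
one-periodic, and `(x, y) ↦ K (x - y)` is symmetric and positive semidefinite. -/
structure IsPeriodicCovariance (K : ℝ → ℝ) : Prop where
  continuous : Continuous K
  periodic : Function.Periodic K 1
  posSemidef : ∀ (n : ℕ) (x : Fin n → ℝ),
    (Matrix.of fun i j : Fin n => K (x i - x j)).PosSemidef

/-- The trigonometric function `e_n(x) = exp (2 π i n x)`. -/
def trig (n : ℤ) (x : ℝ) : ℂ := fourier n (x : UnitAddCircle)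

/-- The Fourier coefficient `∫₀¹ exp (-2 π i n x) f(x) dx` of a real function. -/
def fcoeff (f : ℝ → ℝ) (n : ℤ) : ℂ :=
  fourierCoeffOn (zero_lt_one (α := ℝ)) (fun x => (f x : ℂ)) n

/-- The covariance operator `(𝐊 f)(x) = ∫₀¹ K (x - y) f(y) dy`. -/
def covOp (K : ℝ → ℝ) (f : ℝ → ℂ) (x : ℝ) : ℂ :=
  ∫ y in (0 : ℝ)..1, (K (x - y) : ℂ) * f y

theorem fcoeff_eq_integral (f : ℝ → ℝ) (n : ℤ) :
    fcoeff f n = ∫ x in (0 : ℝ)..1, trig (-n) x * (f x : ℂ) := by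
  have h : ∀ x : ℝ, (fourier (-n) (x : AddCircle ((1 : ℝ) - 0)) : ℂ) = trig (-n) x := by
    intro x
    simp [trig]
  rw [fcoeff, fourierCoeffOn_eq_integral]
  simp only [h, smul_eq_mul]
  simp

/-- The eigenvalues of `𝐊` are the Fourier coefficients of `K`, with eigenfunctions `e_n`. -/
theorem covOp_trig {K : ℝ → ℝ} (hK : Function.Periodic K 1) (n : ℤ) (x : ℝ) :
    covOp K (trig n) x = fcoeff K n * trig n x := by
  have hmul : ∀ y : ℝ, trig n (x - y) = trig (-n) y * trig n x := by
    intro y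
    simp only [trig, fourier_coe_apply, ← Complex.exp_add]
    congr 1
    push_cast
    ring
  have hper : Function.Periodic (fun y : ℝ => (K y : ℂ) * trig n (x - y)) 1 := by
    intro y
    have h1 : trig n (x - (y + 1)) = trig n (x - y) := by
      simp only [trig]
      congr 1
      rw [show x - (y + 1) = (x - y) - 1 by ring, AddCircle.coe_sub, AddCircle.coe_period,
        sub_zero]
    simp only [hK y, h1]
  have h2 : covOp K (trig n) x = ∫ y in (x - 1)..(x - 0), (K y : ℂ) * trig n (x - y) := by
    rw [covOp, ← intervalIntegral.integral_comp_sub_left]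
    simp
  have h3 := hper.intervalIntegral_add_eq (x - 1) 0
  rw [h2, fcoeff_eq_integral, ← intervalIntegral.integral_mul_const]
  rw [show x - 1 + 1 = x - 0 by ring, zero_add] at h3
  rw [h3]
  refine intervalIntegral.integral_congr fun y _ => ?_
  simp only [hmul]
  ring

/-- The quadratic form `⟨q, 𝐊⁻¹ q⟩` in the eigenbasis of `𝐊`, with values in `[0, ∞]`:
`∑ₙ |q̂(n)|² / K̂(n)`. A mode with `q̂(n) = 0` contributes `0`, and a mode with `K̂(n) = 0` and
`q̂(n) ≠ 0` contributes `∞`, so the form is finite exactly on the range of `𝐊^{1/2}`. -/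
def invForm (K q : ℝ → ℝ) : ℝ≥0∞ :=
  ∑' n : ℤ, ‖fcoeff q n‖ₑ ^ 2 / ENNReal.ofReal (fcoeff K n).re

/-- The functional `J(q) = ½ ⟨q, 𝐊⁻¹ q⟩`. -/
def energyJ (K q : ℝ → ℝ) : ℝ≥0∞ := invForm K q / 2

/-- The set `A_l` of potentials `q = l + p' + p²` with `p` smooth, one-periodic, of mean zero. -/
def riccatiSet (l : ℝ) : Set (ℝ → ℝ) :=
  {q | ∃ p : ℝ → ℝ, ContDiff ℝ ∞ p ∧ Function.Periodic p 1 ∧ (∫ x in (0 : ℝ)..1, p x) = 0 ∧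
    ∀ x, q x = l + deriv p x + p x ^ 2}

end

/-! ### Continuous periodic functions and Riemann sums -/

/-! The bound holds for each nonzero `l`, not only in the limit. Since `p` has mean zero, `u = exp
(∫ p)` is periodic and `u'' = (q - l) u`; `u''` vanishes somewhere, so `q c = l` at some `c`
(`exists_eq_of_mem_riccatiSet`). Evaluation at `c` is controlled by the form: by Cauchy–Schwarz, `|q
c|² ≤ (∑ |q̂|)² ≤ (∑ |q̂|² / K̂) (∑ K̂) ≤ 2 J(q) K(0)`. The last step is the trace bound
`sum_fcoeff_re_le`. It rests on `K̂ ≥ 0`, obtained by discretising the positive semidefinite form,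
and on testing `K ≤ K 0` against Fejér kernels. -/

theorem Function.Periodic.uniformContinuous {g : ℝ → ℝ} (hp : Function.Periodic g 1)
    (hg : Continuous g) : UniformContinuous g := by
  have hl : Continuous (hp.lift : UnitAddCircle → ℝ) := hg.quotient_lift _
  have hc : UniformContinuous ((↑) : ℝ → UnitAddCircle) :=
    uniformContinuous_addMonoidHom_of_continuous
      (f := QuotientAddGroup.mk' (AddSubgroup.zmultiples (1 : ℝ))) continuous_quotient_mk'
  exact (CompactSpace.uniformContinuous_of_continuous hl).comp hc

/-- The equidistant Riemann sums of a continuous one-periodic function converge to its integral,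
uniformly in the starting point. -/
theorem exists_riemannSum_approx {g : ℝ → ℝ} (hp : Function.Periodic g 1) (hg : Continuous g)
    {ε : ℝ} (hε : 0 < ε) : ∃ N : ℕ, 0 < N ∧ ∀ t : ℝ,
      |(∑ j ∈ Finset.range N, g (t + j / N)) - N * ∫ x in (0 : ℝ)..1, g x| ≤ N * ε := by
  obtain ⟨δ, hδ, h⟩ := Metric.uniformContinuous_iff.1 (hp.uniformContinuous hg) ε hε
  obtain ⟨n, hn⟩ := exists_nat_one_div_lt hδ
  refine ⟨n + 1, n.succ_pos, fun t => ?_⟩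
  set N : ℕ := n + 1 with hN
  have hN0 : (0 : ℝ) < N := by positivity
  have hNδ : (1 : ℝ) / N < δ := by rw [hN]; push_cast; exact hn
  have hI : ∫ x in (0 : ℝ)..1, g x =
      ∑ j ∈ Finset.range N, ∫ x in (t + (j : ℕ) / N)..(t + ((j + 1 : ℕ) : ℝ) / N), g x := by
    have h0 := hp.intervalIntegral_add_eq 0 t
    rw [zero_add] at h0
    rw [h0, intervalIntegral.sum_integral_adjacent_intervals (a := fun j : ℕ => t + (j : ℝ) / N)
      fun k _ => hg.intervalIntegrable _ _]
    simp
  rw [hI, Finset.mul_sum, ← Finset.sum_sub_distrib]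
  refine (Finset.abs_sum_le_sum_abs _ _).trans ?_
  have hterm : ∀ j ∈ Finset.range N, |g (t + j / N) -
      N * ∫ x in (t + (j : ℕ) / N)..(t + ((j + 1 : ℕ) : ℝ) / N), g x| ≤ ε := by
    intro j _
    have hw : t + ((j + 1 : ℕ) : ℝ) / N - (t + (j : ℕ) / N) = 1 / N := by push_cast; ring
    have h1 : ∫ x in (t + (j : ℕ) / N)..(t + ((j + 1 : ℕ) : ℝ) / N), (g (t + j / N) - g x) =
        g (t + j / N) / N - ∫ x in (t + (j : ℕ) / N)..(t + ((j + 1 : ℕ) : ℝ) / N), g x := by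
      rw [intervalIntegral.integral_sub (by simp) (hg.intervalIntegrable _ _),
        intervalIntegral.integral_const, hw, smul_eq_mul]
      ring
    have h2 := intervalIntegral.norm_integral_le_of_norm_le_const (C := ε)
      (f := fun x => g (t + j / N) - g x)
      (a := t + (j : ℕ) / N) (b := t + ((j + 1 : ℕ) : ℝ) / N) (by
        intro x hx
        have hle : t + (j : ℕ) / N ≤ t + ((j + 1 : ℕ) : ℝ) / N := by
          have : (0 : ℝ) ≤ 1 / N := by positivity
          linarith
        rw [Set.uIoc_of_le hle] at hx
        have : dist (t + (j : ℝ) / N) x < δ := by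
          rw [Real.dist_eq, abs_lt]
          constructor <;> linarith [hx.1, hx.2]
        simpa [Real.dist_eq] using (h this).le)
    rw [h1, hw, abs_of_pos (by positivity), Real.norm_eq_abs] at h2
    calc _ = N * |g (t + j / N) / N -
          ∫ x in (t + (j : ℕ) / N)..(t + ((j + 1 : ℕ) : ℝ) / N), g x| := by
          rw [← abs_of_pos hN0, ← abs_mul, abs_of_pos hN0, mul_sub, mul_div_cancel₀ _ hN0.ne']
      _ ≤ N * (ε * (1 / N)) := by gcongr
      _ = ε := by field_simp
  simpa using Finset.sum_le_sum hterm

/-! ### The eigenvalues of a periodic covariance -/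

theorem trig_eq_exp (n : ℤ) (x : ℝ) : trig n x = Complex.exp (2 * Real.pi * n * x * Complex.I) := by
  rw [trig, fourier_coe_apply]
  congr 1
  push_cast
  ring

theorem continuous_trig (n : ℤ) : Continuous (trig n) := by
  simp only [funext (trig_eq_exp n)]
  fun_prop

theorem fcoeff_re {f : ℝ → ℝ} (hf : Continuous f) (n : ℤ) :
    (fcoeff f n).re = ∫ x in (0 : ℝ)..1, Real.cos (2 * Real.pi * n * x) * f x := by
  rw [fcoeff_eq_integral]
  have hi : IntervalIntegrable (fun x : ℝ => trig (-n) x * (f x : ℂ)) MeasureTheory.volume 0 1 :=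
    ((continuous_trig _).mul (Complex.continuous_ofReal.comp hf)).intervalIntegrable _ _
  have h := Complex.reCLM.intervalIntegral_comp_comm hi
  rw [Complex.reCLM_apply] at h
  rw [← h]
  refine intervalIntegral.integral_congr fun x _ => ?_
  have he : (2 * Real.pi * ((-n : ℤ) : ℂ) * x * Complex.I) =
      ((-(2 * Real.pi * n * x) : ℝ) : ℂ) * Complex.I := by push_cast; ring
  simp only [Complex.reCLM_apply, trig_eq_exp, he, Complex.re_mul_ofReal,
    Complex.exp_ofReal_mul_I_re, Real.cos_neg]

theorem integral_cos_int {n : ℤ} (hn : n ≠ 0) :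
    ∫ x in (0 : ℝ)..1, Real.cos (2 * Real.pi * n * x) = 0 := by
  have hc : 2 * Real.pi * (n : ℝ) ≠ 0 := by
    have := Real.pi_ne_zero
    positivity
  rw [intervalIntegral.integral_comp_mul_left (fun x => Real.cos x) hc, integral_cos]
  have : Real.sin (2 * Real.pi * n * 1) = 0 := by
    rw [show 2 * Real.pi * (n : ℝ) * 1 = ((2 * n : ℤ) : ℝ) * Real.pi by push_cast; ring]
    exact Real.sin_int_mul_pi _
  rw [this]
  simp

/-- Both sides are `|∑ exp (i a_j)|²`; this gives the positivity of the Fejér kernel. -/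
theorem sum_sum_cos_sub {ι : Type*} (s : Finset ι) (a : ι → ℝ) :
    ∑ j ∈ s, ∑ k ∈ s, Real.cos (a j - a k) =
      (∑ j ∈ s, Real.cos (a j)) ^ 2 + (∑ j ∈ s, Real.sin (a j)) ^ 2 := by
  simp only [Real.cos_sub, Finset.sum_add_distrib, sq, Finset.sum_mul_sum]

namespace IsPeriodicCovariance

variable {K : ℝ → ℝ}

theorem quadForm_nonneg (hK : IsPeriodicCovariance K) {n : ℕ} (x v : Fin n → ℝ) :
    0 ≤ ∑ i, ∑ j, v i * v j * K (x i - x j) := by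
  have h := (hK.posSemidef n x).dotProduct_mulVec_nonneg v
  simp only [dotProduct, Matrix.mulVec, Matrix.of_apply, Pi.star_apply, star_trivial,
    Finset.mul_sum] at h
  refine h.trans_eq (Finset.sum_congr rfl fun i _ => Finset.sum_congr rfl fun j _ => by ring)

/-- Two points with weights `1, -1` give `2 K(0) - K(x) - K(-x) ≥ 0`, and symmetry gives `K(-x) =
K(x)`. -/
theorem le_apply_zero (hK : IsPeriodicCovariance K) (x : ℝ) : K x ≤ K 0 := by
  have h := hK.quadForm_nonneg ![x, 0] ![1, -1]
  have hs := (hK.posSemidef 2 ![x, 0]).isHermitian.apply 0 1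
  simp [Fin.sum_univ_two] at h hs
  linarith

theorem fcoeff_re_nonneg (hK : IsPeriodicCovariance K) (n : ℤ) : 0 ≤ (fcoeff K n).re := by
  set g : ℝ → ℝ := fun x => Real.cos (2 * Real.pi * n * x) * K x with hg
  have hgc : Continuous g := by
    have := hK.continuous
    fun_prop
  have hgp : Function.Periodic g 1 := by
    intro x
    simp only [hg, hK.periodic x]
    rw [show 2 * Real.pi * n * (x + 1) = 2 * Real.pi * n * x + n * (2 * Real.pi) by ring,
      Real.cos_add_int_mul_two_pi]
  rw [fcoeff_re hK.continuous]
  change 0 ≤ ∫ x in (0 : ℝ)..1, g x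
  refine le_of_forall_pos_le_add fun ε hε => ?_
  obtain ⟨N, hN, h⟩ := exists_riemannSum_approx hgp hgc hε
  have hN0 : (0 : ℝ) < N := by exact_mod_cast hN
  -- Cosine and sine weights at equidistant points add up to a double sum of `g (x_j - x_k)`. For
  -- fixed `k` this is a Riemann sum of `g` started at `-k/N`, hence the need for uniformity in the
  -- start.
  have hc := hK.quadForm_nonneg (fun i : Fin N => (i : ℝ) / N)
    fun i => Real.cos (2 * Real.pi * n * ((i : ℝ) / N))
  have hs := hK.quadForm_nonneg (fun i : Fin N => (i : ℝ) / N)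
    fun i => Real.sin (2 * Real.pi * n * ((i : ℝ) / N))
  have hle : 0 ≤ ∑ k : Fin N, ∑ j : Fin N, g (-((k : ℝ) / N) + (j : ℝ) / N) := by
    rw [Finset.sum_comm]
    refine (add_nonneg hc hs).trans_eq ?_
    simp only [← Finset.sum_add_distrib, ← add_mul]
    refine Finset.sum_congr rfl fun j _ => Finset.sum_congr rfl fun k _ => ?_
    rw [← Real.cos_sub, ← mul_sub, neg_add_eq_sub]
  have hub : ∑ k : Fin N, ∑ j : Fin N, g (-((k : ℝ) / N) + (j : ℝ) / N) ≤
      ∑ _k : Fin N, N * ((∫ x in (0 : ℝ)..1, g x) + ε) := by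
    refine Finset.sum_le_sum fun k _ => ?_
    rw [Fin.sum_univ_eq_sum_range fun j => g (-((k : ℝ) / N) + (j : ℝ) / N)]
    linarith [(abs_le.1 (h (-((k : ℝ) / N)))).2]
  have h3 := hle.trans hub
  rw [Finset.sum_const, Finset.card_univ, Fintype.card_fin, nsmul_eq_mul] at h3
  exact nonneg_of_mul_nonneg_right (nonneg_of_mul_nonneg_right h3 hN0) hN0

/-- The average of `K` against the Fejér kernel is at most `K 0`. -/
theorem sum_sum_fcoeff_re_le (hK : IsPeriodicCovariance K) (M : ℕ) :
    ∑ j ∈ Finset.range M, ∑ k ∈ Finset.range M, (fcoeff K ((j : ℤ) - k)).re ≤ M * K 0 := by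
  set F : ℝ → ℝ := fun x => ∑ j ∈ Finset.range M, ∑ k ∈ Finset.range M,
    Real.cos (2 * Real.pi * ((j : ℤ) - k : ℤ) * x) with hF
  have hFc : Continuous F := by fun_prop
  have hF0 : ∀ x, 0 ≤ F x := by
    intro x
    have := sum_sum_cos_sub (Finset.range M) fun j => 2 * Real.pi * j * x
    have h : F x = ∑ j ∈ Finset.range M, ∑ k ∈ Finset.range M,
        Real.cos (2 * Real.pi * j * x - 2 * Real.pi * k * x) := by
      refine Finset.sum_congr rfl fun j _ => Finset.sum_congr rfl fun k _ => ?_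
      congr 1
      push_cast
      ring
    rw [h, this]
    positivity
  have hsum : ∀ f : ℝ → ℝ, Continuous f → ∫ x in (0 : ℝ)..1, F x * f x =
      ∑ j ∈ Finset.range M, ∑ k ∈ Finset.range M, ∫ x in (0 : ℝ)..1,
        Real.cos (2 * Real.pi * ((j : ℤ) - k : ℤ) * x) * f x := by
    intro f hf
    simp only [hF, Finset.sum_mul]
    rw [intervalIntegral.integral_finsetSum fun j _ =>
      Continuous.intervalIntegrable (by fun_prop) _ _]
    refine Finset.sum_congr rfl fun j _ => ?_
    rw [intervalIntegral.integral_finsetSum fun j _ =>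
      Continuous.intervalIntegrable (by fun_prop) _ _]
  -- Only the diagonal frequencies `j = k` survive integration.
  have hone : ∫ x in (0 : ℝ)..1, F x * K 0 = M * K 0 := by
    rw [hsum _ continuous_const]
    have : ∀ j ∈ Finset.range M, ∑ k ∈ Finset.range M, ∫ x in (0 : ℝ)..1,
        Real.cos (2 * Real.pi * ((j : ℤ) - k : ℤ) * x) * K 0 = K 0 := by
      intro j hj
      rw [Finset.sum_eq_single_of_mem j hj]
      · simp
      · intro k _ hkj
        rw [intervalIntegral.integral_mul_const,
          integral_cos_int (by rw [sub_ne_zero]; exact_mod_cast hkj.symm), zero_mul]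
    rw [Finset.sum_congr rfl this]
    simp
  simp only [fcoeff_re hK.continuous]
  rw [← hsum K hK.continuous, ← hone]
  refine intervalIntegral.integral_mono_on zero_le_one
    ((hFc.mul hK.continuous).intervalIntegrable _ _)
    ((hFc.mul continuous_const).intervalIntegrable _ _) fun x _ => ?_
  exact mul_le_mul_of_nonneg_left (hK.le_apply_zero x) (hF0 x)

/-- The trace bound: the eigenvalues of the covariance operator sum to at most `K 0`. -/
theorem sum_fcoeff_re_le (hK : IsPeriodicCovariance K) (S : Finset ℤ) :
    ∑ n ∈ S, (fcoeff K n).re ≤ K 0 := by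
  set s := ∑ n ∈ S, (fcoeff K n).re with hs
  obtain ⟨L, hL⟩ : ∃ L : ℕ, ∀ n ∈ S, n.natAbs ≤ L :=
    ⟨S.sup Int.natAbs, fun n hn => Finset.le_sup (f := Int.natAbs) hn⟩
  -- For `k` in `[L, L + T)` and `|n| ≤ L`, the index `j = n + k` lies in `[0, T + 2L)`. So each of
  -- these `T` values of `k` contributes at least `s` to the Fejér double sum.
  have key : ∀ T : ℕ, T * s ≤ (T + 2 * L) * K 0 := by
    intro T
    have h := hK.sum_sum_fcoeff_re_le (T + 2 * L)
    rw [Finset.sum_comm] at h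
    push_cast at h
    refine le_trans ?_ h
    have h1 : (T : ℝ) * s = ∑ k ∈ Finset.Ico L (L + T), s := by simp
    rw [h1]
    refine (Finset.sum_le_sum fun k hk => ?_).trans (Finset.sum_le_sum_of_subset_of_nonneg
      (s := Finset.Ico L (L + T)) (fun k hk => ?_)
      fun k _ _ => Finset.sum_nonneg fun j _ => hK.fcoeff_re_nonneg _)
    · rw [Finset.mem_Ico] at hk
      have hinj : Set.InjOn (fun n : ℤ => (n + k).toNat) S := by
        intro a ha b hb hab
        have := hL a ha
        have := hL b hb
        simp only at hab
        omega
      calc s = ∑ n ∈ S, (fcoeff K (((n + k).toNat : ℤ) - k)).re := by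
            refine Finset.sum_congr rfl fun n hn => ?_
            have := hL n hn
            rw [show ((n + k).toNat : ℤ) - k = n by omega]
        _ = ∑ j ∈ S.image fun n : ℤ => (n + k).toNat, (fcoeff K ((j : ℤ) - k)).re := by
            rw [Finset.sum_image hinj]
        _ ≤ _ := by
            refine Finset.sum_le_sum_of_subset_of_nonneg ?_ fun j _ _ => hK.fcoeff_re_nonneg _
            intro j hj
            obtain ⟨n, hn, rfl⟩ := Finset.mem_image.1 hj
            have := hL n hn
            rw [Finset.mem_range]
            omega
    · rw [Finset.mem_Ico] at hk
      rw [Finset.mem_range]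
      omega
  by_contra! hlt
  -- `key` says `T (s - K 0) ≤ 2 L K 0`, which fails for large `T` if `s > K 0`.
  obtain ⟨T, hT⟩ := exists_nat_gt (2 * L * K 0 / (s - K 0))
  rw [div_lt_iff₀ (by linarith)] at hT
  linarith [key T]

/-- The mean of `K` is its eigenvalue at `n = 0`, so the trace bound applies. -/
theorem apply_zero_pos (hK : IsPeriodicCovariance K) (hpos : 0 < ∫ x in (0 : ℝ)..1, K x) :
    0 < K 0 := by
  have h := hK.sum_fcoeff_re_le {0}
  rw [Finset.sum_singleton, fcoeff_re hK.continuous] at h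
  simp only [Int.cast_zero, mul_zero, zero_mul, Real.cos_zero, one_mul] at h
  exact hpos.trans_le h

end IsPeriodicCovariance
/-! ### Pointwise bound by the quadratic form -/

/-- If the Fourier coefficients of a continuous periodic function have `ℓ¹` norm at most `B`, the
function is bounded by `B`. -/
theorem abs_le_of_sum_norm_fcoeff_le {q : ℝ → ℝ} (hq : Continuous q)
    (hp : Function.Periodic q 1) {B : ℝ} (hB : ∀ S : Finset ℤ, ∑ n ∈ S, ‖fcoeff q n‖ ≤ B) (x : ℝ) :
    |q x| ≤ B := by
  let f : C(UnitAddCircle, ℂ) :=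
    ⟨fun y => (hp.lift y : ℂ), Complex.continuous_ofReal.comp (hq.quotient_lift _)⟩
  have hf : ∀ y : ℝ, f (y : UnitAddCircle) = q y := fun y => rfl
  have hcoeff : ∀ n, fourierCoeff f n = fcoeff q n := by
    intro n
    rw [fcoeff_eq_integral, fourierCoeff_eq_intervalIntegral _ _ 0]
    simp [hf, trig]
  have hs : Summable fun n => ‖fourierCoeff f n‖ := by
    simp only [hcoeff]
    exact summable_of_sum_le (fun n => norm_nonneg _) hB
  have h := has_pointwise_sum_fourier_series_of_summable hs.of_norm (x : UnitAddCircle)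
  have hn : ∀ n, ‖fourierCoeff f n • (fourier n (x : UnitAddCircle) : ℂ)‖ = ‖fcoeff q n‖ := by
    intro n
    rw [norm_smul, hcoeff, fourier_apply, Circle.norm_coe, mul_one]
  have hle : ‖f (x : UnitAddCircle)‖ ≤ B := by
    rw [← h.tsum_eq]
    refine (norm_tsum_le_tsum_norm ?_).trans ?_
    · rw [funext hn]
      simpa only [hcoeff] using hs
    · simp only [hn]
      exact Real.tsum_le_of_sum_le (fun n => norm_nonneg _) hB
  rwa [hf, Complex.norm_real, Real.norm_eq_abs] at hle

theorem sum_norm_fcoeff_sq_le {K q : ℝ → ℝ} (hK : IsPeriodicCovariance K)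
    (hfin : invForm K q ≠ ⊤) (S : Finset ℤ) :
    (∑ n ∈ S, ‖fcoeff q n‖) ^ 2 ≤ (invForm K q).toReal * K 0 := by
  set t : ℤ → ℝ≥0∞ := fun n => ‖fcoeff q n‖ₑ ^ 2 / ENNReal.ofReal (fcoeff K n).re with ht
  have htop : ∀ n, t n ≠ ⊤ := ENNReal.ne_top_of_tsum_ne_top hfin
  have hsq : ∀ n, ‖fcoeff q n‖ ^ 2 ≤ (t n).toReal * (fcoeff K n).re := by
    intro n
    -- Finiteness of the form forces `q̂(n) = 0` wherever `K̂(n) = 0`.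
    rcases (hK.fcoeff_re_nonneg n).eq_or_lt with h0 | h0
    · have : ‖fcoeff q n‖ₑ ^ 2 = 0 := by
        by_contra hne
        exact htop n (by simp only [ht, ← h0, ENNReal.ofReal_zero, ENNReal.div_zero hne])
      have hz : fcoeff q n = 0 := by simpa using this
      rw [hz, ← h0]
      simp
    · simp only [ht, ENNReal.toReal_div, ENNReal.toReal_pow, toReal_enorm,
        ENNReal.toReal_ofReal h0.le]
      rw [div_mul_cancel₀ _ h0.ne']
  have hsum : ∑ n ∈ S, (t n).toReal ≤ (invForm K q).toReal := by
    rw [← ENNReal.toReal_sum fun n _ => htop n]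
    exact ENNReal.toReal_mono hfin (ENNReal.sum_le_tsum S)
  refine (Finset.sum_sq_le_sum_mul_sum_of_sq_le_mul S (fun n _ => ENNReal.toReal_nonneg)
    (fun n _ => hK.fcoeff_re_nonneg n) fun n _ => hsq n).trans ?_
  exact mul_le_mul hsum (hK.sum_fcoeff_re_le S)
    (Finset.sum_nonneg fun n _ => hK.fcoeff_re_nonneg n) ENNReal.toReal_nonneg

/-- Evaluation at a point has norm at most `√(K 0)` for the form `⟨q, 𝐊⁻¹ q⟩`. -/
theorem ofReal_sq_div_le_invForm {K q : ℝ → ℝ} (hK : IsPeriodicCovariance K) (h0 : 0 < K 0)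
    (hq : Continuous q) (hp : Function.Periodic q 1) (x : ℝ) :
    ENNReal.ofReal (q x ^ 2 / K 0) ≤ invForm K q := by
  rcases eq_or_ne (invForm K q) ⊤ with hfin | hfin
  · simp [hfin]
  rw [ENNReal.ofReal_le_iff_le_toReal hfin, div_le_iff₀ h0, ← sq_abs]
  have h := abs_le_of_sum_norm_fcoeff_le hq hp
    (fun S => Real.le_sqrt_of_sq_le (sum_norm_fcoeff_sq_le hK hfin S)) x
  exact (Real.le_sqrt (abs_nonneg _) (mul_nonneg ENNReal.toReal_nonneg h0.le)).1 h

/-! ### Riccati potentials -/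

/-- A potential `l + p' + p²` with `p` of mean zero takes the value `l`: the function
`u = exp (∫ p)` is periodic with `u'' = (p' + p²) u`, and Rolle's theorem applies to `u'`. -/
theorem exists_eq_of_mem_riccatiSet {l : ℝ} {q : ℝ → ℝ} (hq : q ∈ riccatiSet l) :
    ∃ c, q c = l := by
  obtain ⟨p, hp, hper, hint, hqp⟩ := hq
  have hP : ∀ x, HasDerivAt (fun y => ∫ s in (0 : ℝ)..y, p s) (p x) x := fun x =>
    intervalIntegral.integral_hasDerivAt_right (hp.continuous.intervalIntegrable _ _)
      (hp.continuous.stronglyMeasurableAtFilter _ _) hp.continuous.continuousAt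
  have hd : ∀ x, HasDerivAt (fun y => p y * Real.exp (∫ s in (0 : ℝ)..y, p s))
      ((deriv p x + p x ^ 2) * Real.exp (∫ s in (0 : ℝ)..x, p s)) x := by
    intro x
    have h1 : HasDerivAt p (deriv p x) x := (hp.differentiable (by simp)).differentiableAt.hasDerivAt
    convert! h1.mul (hP x).exp using 1
    ring
  obtain ⟨c, -, hc⟩ := exists_hasDerivAt_eq_zero zero_lt_one
    (fun x _ => (hd x).continuousAt.continuousWithinAt)
    (by
      -- Mean zero makes `exp (∫ p)` equal to `1` at both endpoints, so `u'` agrees there.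
      have h1 : p 1 = p 0 := by simpa using hper 0
      simp [hint, h1]) fun x _ => hd x
  refine ⟨c, ?_⟩
  have := (mul_eq_zero.1 hc).resolve_right (Real.exp_ne_zero _)
  rw [hqp]
  linarith

theorem continuous_of_mem_riccatiSet {l : ℝ} {q : ℝ → ℝ} (hq : q ∈ riccatiSet l) :
    Continuous q := by
  obtain ⟨p, hp, -, -, hqp⟩ := hq
  have h1 : Continuous (deriv p) := hp.continuous_deriv (by simp)
  have h2 := hp.continuous
  rw [funext hqp]
  fun_prop

theorem periodic_of_mem_riccatiSet {l : ℝ} {q : ℝ → ℝ} (hq : q ∈ riccatiSet l) :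
    Function.Periodic q 1 := by
  obtain ⟨p, -, hper, -, hqp⟩ := hq
  intro x
  have h : deriv p (x + 1) = deriv p x := by
    rw [← deriv_comp_add_const, funext hper]
  rw [hqp, hqp, h, hper]

theorem le_energyJ_of_mem_riccatiSet {K q : ℝ → ℝ} (hK : IsPeriodicCovariance K) (h0 : 0 < K 0)
    {l : ℝ} (hq : q ∈ riccatiSet l) : ENNReal.ofReal (1 / (2 * K 0) * l ^ 2) ≤ energyJ K q := by
  obtain ⟨c, hc⟩ := exists_eq_of_mem_riccatiSet hq
  have h := ofReal_sq_div_le_invForm hK h0 (continuous_of_mem_riccatiSet hq)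
    (periodic_of_mem_riccatiSet hq) c
  rw [hc] at h
  rw [energyJ, show 1 / (2 * K 0) * l ^ 2 = l ^ 2 / K 0 / 2 by field_simp,
    ENNReal.ofReal_div_of_pos two_pos, ENNReal.ofReal_ofNat]
  gcongr

theorem theorem4 (K : ℝ → ℝ) (hK : IsPeriodicCovariance K)
    (hpos : 0 < ∫ x in (0 : ℝ)..1, K x) :
    ENNReal.ofReal (1 / (2 * K 0)) ≤
      liminf (fun l : ℝ => (⨅ q ∈ riccatiSet l, energyJ K q) / ENNReal.ofReal (l ^ 2)) atBot := by
  have h0 := hK.apply_zero_pos hpos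
  refine le_liminf_of_le (by isBoundedDefault) ?_
  -- Negativity of `l` serves only to make `l ^ 2` nonzero.
  filter_upwards [eventually_lt_atBot (0 : ℝ)] with l hl
  have hl2 : 0 < l ^ 2 := sq_pos_of_neg hl
  rw [ENNReal.le_div_iff_mul_le (Or.inl (ENNReal.ofReal_pos.2 hl2).ne')
    (Or.inl ENNReal.ofReal_ne_top), ← ENNReal.ofReal_mul (by positivity)]
  exact le_iInf₂ fun q hq => le_energyJ_of_mem_riccatiSet hK h0 hq
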